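/- Fix an integer $N\ge 0$ and let $[N]^*$ be the set of finite words over the alphabet $[N]=\{1,2,\dots,N\}$. Two words in $[N]^*$ are $\#$-Sylvester adjacent if, in one of the two orders, they have the form $u\,b\,v\,a\,c\,w$ and $u\,b\,v\,c\,a\,w$ with $u,v,w\in[N]^*$ and letters $a<b\le c$ in $[N]$; $\#$-Sylvester equivalence is the equivalence relation on $[N]^*$ generated by adjacency, and its equivalence classes are the $\#$-Sylvester classes. The content of a word is the sequence $(c_1,\dots,c_N)$, where $c_m$ is the number of occurrences of the letter $m$; its packed content is the sequence obtained from the content by deleting the zeros. Let $\alpha=(\alpha_1,\dots,\alpha_k)$ be a composition (a finite, possibly empty, sequence of positive integers), and let $c=(c_1,\dots,c_N)$ be any content whose packed content is $\alpha$, that is, any sequence of nonnegative integers from which deleting the zeros leaves $\alpha$. Then the number of $\#$-Sylvester classes of words with content $c$ is finite and equals $$\det\left[\binom{j+\sum_{\ell=1}^{i}\alpha_\ell}{j-i+1}\right]_{1\le i,j\le k-1},$$ where $\binom{m}{r}=0$ for $r<0$ and the determinant of an empty matrix is $1$. -/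

import Mathlib

/-- Words `w₁`, `w₂` over an ordered alphabet are `#`-Sylvester adjacent (in this order) when
`w₁ = u b v a c w` and `w₂ = u b v c a w` for some words `u, v, w` and letters `a < b ≤ c`. -/
def SharpSylvAdj {A : Type*} [LinearOrder A] (w₁ w₂ : List A) : Prop :=
  ∃ (u v w : List A) (a b c : A), a < b ∧ b ≤ c ∧
    w₁ = u ++ [b] ++ v ++ [a, c] ++ w ∧ w₂ = u ++ [b] ++ v ++ [c, a] ++ w

/-- `#`-Sylvester equivalence: two words are equivalent when they are joined by a finite sequence
of words in which any two consecutive ones are `#`-Sylvester adjacent (in one of the two orders),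
i.e. the equivalence relation generated by `SharpSylvAdj`. -/
def sharpSylvSetoid (A : Type*) [LinearOrder A] : Setoid (List A) :=
  Relation.EqvGen.setoid SharpSylvAdj

/-- The content of a word over the alphabet `[N]`: the weak composition recording how often each
letter occurs. The ordered alphabet `[N]` is modelled by `Fin N`. -/
def wordContent {N : ℕ} (w : List (Fin N)) : Fin N → ℕ := fun a => w.count a

/-- The packing of a weak composition: the list of its nonzero parts, in order. The packed content
of a word is the packing of its content. -/
def packing {N : ℕ} (c : Fin N → ℕ) : List ℕ := (List.ofFn c).filter (fun m => m ≠ 0)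

/-- The set of `#`-Sylvester classes, among all words over `[N]`, of the words with content `c`. -/
def sharpSylvClasses {N : ℕ} (c : Fin N → ℕ) : Set (Quotient (sharpSylvSetoid (Fin N))) :=
  Quotient.mk (sharpSylvSetoid (Fin N)) '' {w | wordContent w = c}

/-- The binomial coefficient with an integer lower entry, equal to `0` when that entry is
negative. -/
def binom (m : ℕ) (r : ℤ) : ℤ := if 0 ≤ r then (m.choose r.toNat : ℤ) else 0

/-- The `(k - 1) × (k - 1)` matrix, `k` the number of parts of `α`, whose `(i, j)` entry (for
`1 ≤ i, j ≤ k - 1`) is `binom (j + (α₁ + ⋯ + αᵢ)) (j - (i - 1))`. The elements of `Fin (k - 1)`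
start at `0`, so `i` and `j` below are shifted by one; `α.sizeUpTo i` is `α₁ + ⋯ + αᵢ`. -/
def sharpSylvMatrix {n : ℕ} (α : Composition n) :
    Matrix (Fin (α.length - 1)) (Fin (α.length - 1)) ℤ :=
  Matrix.of fun i' j' =>
    let i : ℕ := i'.val + 1
    let j : ℕ := j'.val + 1
    binom (j + α.sizeUpTo i) ((j : ℤ) - ((i : ℤ) - 1))

/-!
Inserting the letters of a word from left to right into a binary search tree, equal letters going to
the right, gives a complete invariant of `#`-Sylvester classes (`sharpSylv_iff_ofWord_eq`). Letters
`a < b ≤ c` that follow a `b` are sent to different subtrees, so their insertions commute;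
conversely these commutations bring a word to the preorder reading of its tree. Hence the classes of
content `c` correspond to the search trees whose inorder reading is the weakly increasing word of
content `c` (`exists_bijOn_sharpSylvClasses`).

The trees are counted by adding the largest label. It is the last node of the path that descends
from the root to the right, and deleting it leaves a tree with one label less. A label larger than
all others can be added at every depth of that path, and it then is the end of the path; a label
equal to the previous one can be added only as a leaf. Recording the length of the path, one obtains
for the trees the recursion of the weakly increasing sequences `x₁ ≤ ⋯ ≤ xₘ` with
`xᵢ ≤ α₁ + ⋯ + αᵢ₋₁` and `m` the number of parts of `α` (`encard_deepSearchTrees_repeatLetters`).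
Here `xᵢ` is the number of labels smaller than the `i`-th letter minus the depth at which the first
copy of that letter is added.

Such sequences are counted by the determinant. Weighting the last term by a binomial coefficient and
summing by parts gives a telescoping alternating sum (`alternating_sum_boundedSeqCount`). It says
that a combination of the rows of the matrix vanishes except in the last column, and this evaluates
the determinant, since the matrix is Hessenberg with subdiagonal entries `1`
(`Matrix.det_hessenberg`).
-/

/-! ### Bounded weakly increasing sequences -/

open Finset in
/-- The number of weakly increasing sequences `x₁ ≤ ⋯ ≤ xₘ ≤ x` of natural numbers with
`xᵢ ≤ s (i - 1)` for each `i`, computed by summing over the last term. -/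
def boundedSeqCount (s : ℕ → ℕ) : ℕ → ℕ → ℕ
  | 0, _ => 1
  | m + 1, x => ∑ y ∈ range (x + 1), if y ≤ s m then boundedSeqCount s m y else 0

section BoundedSeqCount

open Finset

variable {s : ℕ → ℕ}

theorem boundedSeqCount_succ_zero (m : ℕ) :
    boundedSeqCount s (m + 1) 0 = boundedSeqCount s m 0 := by
  simp [boundedSeqCount]

theorem boundedSeqCount_succ_succ (m x : ℕ) :
    boundedSeqCount s (m + 1) (x + 1) =
      boundedSeqCount s (m + 1) x + if x + 1 ≤ s m then boundedSeqCount s m (x + 1) else 0 := by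
  simp only [boundedSeqCount, sum_range_succ _ (x + 1)]

theorem sum_range_ite_le {M : Type*} [AddCommMonoid M] (g : ℕ → M) {a b : ℕ} (h : a ≤ b) :
    ∑ y ∈ range (b + 1), (if y ≤ a then g y else 0) = ∑ y ∈ range (a + 1), g y := by
  rw [← sum_filter]
  congr 1
  ext y
  simp only [mem_filter, mem_range]
  omega

theorem boundedSeqCount_succ_of_le (m : ℕ) {x : ℕ} (h : s m ≤ x) :
    boundedSeqCount s (m + 1) x = ∑ y ∈ range (s m + 1), boundedSeqCount s m y := by
  rw [boundedSeqCount, sum_range_ite_le _ h]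

/-- `boundedSeqCount s m` depends only on the first `m` bounds. -/
theorem boundedSeqCount_congr {s' : ℕ → ℕ} (m x : ℕ) (h : ∀ i < m, s i = s' i) :
    boundedSeqCount s m x = boundedSeqCount s' m x := by
  induction m generalizing x with
  | zero => rfl
  | succ m ih =>
    simp only [boundedSeqCount, h m (Nat.lt_succ_self m),
      fun y => ih y fun i hi => h i (Nat.lt_succ_of_lt hi)]

/-- Summation by parts, the difference of `boundedSeqCount s (m + 1)` being given by
`boundedSeqCount s m` and that of a binomial coefficient by Pascal's rule. -/
theorem boundedSeqCount_mul_choose (m t r x : ℕ) :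
    boundedSeqCount s (m + 1) x * (x + 1 + t).choose (r + 1) =
      (∑ y ∈ range (x + 1),
        if y ≤ s m then boundedSeqCount s m y * (y + t).choose (r + 1) else 0) +
      ∑ y ∈ range (x + 1), boundedSeqCount s (m + 1) y * (y + t).choose r := by
  induction x with
  | zero =>
    have : (0 + 1 + t).choose (r + 1) = t.choose r + t.choose (r + 1) := by
      rw [show 0 + 1 + t = t + 1 by omega, Nat.choose_succ_succ]
    simp [boundedSeqCount_succ_zero, this]
    ring
  | succ x ih =>
    have : (x + 1 + 1 + t).choose (r + 1) =
        (x + 1 + t).choose r + (x + 1 + t).choose (r + 1) := by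
      rw [show x + 1 + 1 + t = (x + 1 + t) + 1 by omega, Nat.choose_succ_succ]
    rw [sum_range_succ, sum_range_succ _ (x + 1), this, boundedSeqCount_succ_succ]
    split_ifs with h
    · linear_combination ih
    · linear_combination ih

/-- The number of sequences `x₁ ≤ ⋯ ≤ xₘ` with `xᵢ ≤ s (i - 1)`, each weighted by the binomial
coefficient of `xₘ + t` over `r`. -/
def weightedSeqCount (s : ℕ → ℕ) (t m r : ℕ) : ℕ :=
  ∑ y ∈ range (s m + 1), boundedSeqCount s m y * (y + t).choose r

theorem boundedSeqCount_mul_choose_eq_add (hs : Monotone s) (t m r : ℕ) :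
    boundedSeqCount s (m + 1) (s m) * (s (m + 1) + 1 + t).choose (r + 1) =
      weightedSeqCount s t m (r + 1) + weightedSeqCount s t (m + 1) r := by
  have h : s m ≤ s (m + 1) := hs (Nat.le_succ m)
  have := boundedSeqCount_mul_choose (s := s) m t r (s (m + 1))
  rw [sum_range_ite_le (fun y => boundedSeqCount s m y * (y + t).choose (r + 1)) h] at this
  rw [boundedSeqCount_succ_of_le m le_rfl, ← boundedSeqCount_succ_of_le m h, this]
  rfl

/-- The two terms on the right of `boundedSeqCount_mul_choose_eq_add` telescope in an alternating
sum. -/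
theorem alternating_sum_boundedSeqCount (hs : Monotone s) (h0 : s 0 = 0) (t l : ℕ) :
    ∑ i ∈ range (l + 1), (-1 : ℤ) ^ i * boundedSeqCount s (i + 1) (s i) *
      ((s (i + 1) + 1 + t).choose (l - i) : ℤ) = (t.choose l : ℤ) := by
  have key : ∀ m ≤ l, ∑ i ∈ range m, (-1 : ℤ) ^ i * boundedSeqCount s (i + 1) (s i) *
      ((s (i + 1) + 1 + t).choose (l - i) : ℤ) =
      (t.choose l : ℤ) - (-1) ^ m * weightedSeqCount s t m (l - m) := by
    intro m
    induction m with
    | zero => simp [weightedSeqCount, h0, boundedSeqCount]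
    | succ m ih =>
      intro hm
      have e : l - m = (l - (m + 1)) + 1 := by omega
      have := boundedSeqCount_mul_choose_eq_add hs t m (l - (m + 1))
      rw [← e] at this
      zify at this
      rw [sum_range_succ, ih (by omega), mul_assoc, this]
      ring
  have hl : weightedSeqCount s t l 0 = boundedSeqCount s (l + 1) (s l) := by
    simp [weightedSeqCount, boundedSeqCount_succ_of_le l le_rfl]
  rw [sum_range_succ, key l le_rfl, Nat.sub_self, hl]
  simp

end BoundedSeqCount

/-! ### The determinant -/

open Finset in
/-- A Hessenberg matrix whose subdiagonal entries are `1` has the determinant that the recursion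
along its columns predicts: the combination of the rows with coefficients `(-1) ^ i * f i` is zero
except in the last column, and it may replace the first row. -/
theorem Matrix.det_hessenberg {R : Type*} [CommRing R] (a : ℕ → ℕ → R) (f : ℕ → R) (h0 : f 0 = 1)
    (hsub : ∀ j, a (j + 1) j = 1) (hzero : ∀ i j, j + 1 < i → a i j = 0)
    (hrec : ∀ j, ∑ i ∈ range (j + 2), (-1) ^ i * f i * a i j = 0) (m : ℕ) :
    (Matrix.of fun i j : Fin m => a i j).det = f m := by
  cases m with
  | zero => simp [h0]
  | succ m =>
    set A : Matrix (Fin (m + 1)) (Fin (m + 1)) R := Matrix.of fun i j => a i j with hA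
    have hrow : (∑ k : Fin (m + 1), ((-1) ^ (k : ℕ) * f k) • A k) =
        fun j => if j = Fin.last m then (-1) ^ m * f (m + 1) else 0 := by
      funext j
      have e : (∑ k : Fin (m + 1), ((-1) ^ (k : ℕ) * f k) • A k) j =
          ∑ i ∈ range (m + 1), (-1) ^ i * f i * a i j := by
        rw [← Fin.sum_univ_eq_sum_range (fun i => (-1) ^ i * f i * a i j)]
        simp [hA]
      rw [e]
      split_ifs with hj
      · subst hj
        have := hrec m
        rw [sum_range_succ, hsub] at this
        rw [Fin.val_last]
        linear_combination this
      · have hj' : (j : ℕ) + 2 ≤ m + 1 := by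
          have : (j : ℕ) ≠ m := fun h => hj (Fin.ext h)
          omega
        rw [← hrec j]
        refine (sum_subset (range_subset_range.2 hj') fun i _ hi => ?_).symm
        rw [hzero i j (by simp at hi; omega), mul_zero]
    have hdet := Matrix.det_updateRow_sum A 0 fun k => (-1) ^ (k : ℕ) * f k
    have hminor : (((A.updateRow 0 fun j => if j = Fin.last m then (-1) ^ m * f (m + 1) else 0
        ).submatrix Fin.succ (Fin.last m).succAbove).det) = 1 := by
      rw [Matrix.det_of_isUpperTriangular]
      · refine prod_eq_one fun i _ => ?_
        simp [hA, hsub]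
      · intro i j hij
        simp only [id] at hij
        simp only [Matrix.submatrix_apply, Matrix.updateRow_ne (Fin.succ_ne_zero i), hA,
          Matrix.of_apply, Fin.succAbove_last, Fin.val_succ, Fin.val_castSucc]
        exact hzero _ _ (by have : (j : ℕ) < i := hij; omega)
    rw [hrow, Matrix.det_succ_row_zero, sum_eq_single (Fin.last m)] at hdet
    · rw [hminor] at hdet
      simp only [Fin.val_last, Matrix.updateRow_self, if_true, Fin.val_zero, h0, pow_zero, mul_one,
        one_smul, ← mul_assoc, ← mul_pow, neg_mul_neg, one_pow, one_mul] at hdet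
      exact hdet.symm
    · intro j _ hj
      simp [hj]
    · simp

/-- The determinant of the theorem counts the bounded sequences: its columns satisfy the recursion
of `alternating_sum_boundedSeqCount`. -/
theorem det_binom_eq_boundedSeqCount {s : ℕ → ℕ} (hs : Monotone s) (h0 : s 0 = 0) (m : ℕ) :
    (Matrix.of fun i j : Fin m => binom ((j : ℕ) + 1 + s (i + 1))
      (((j : ℕ) + 1 : ℕ) - ((((i : ℕ) + 1 : ℕ) : ℤ) - 1))).det =
      boundedSeqCount s (m + 1) (s m) := by
  have hbinom : ∀ i j : ℕ, i ≤ j + 1 → binom (j + 1 + s (i + 1)) (((j + 1 : ℕ) : ℤ) -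
      (((i + 1 : ℕ) : ℤ) - 1)) = ((s (i + 1) + 1 + j).choose (j + 1 - i) : ℤ) := by
    intro i j h
    have e : ((j + 1 : ℕ) : ℤ) - (((i + 1 : ℕ) : ℤ) - 1) = ((j + 1 - i : ℕ) : ℤ) := by omega
    rw [e, binom, if_pos (by positivity), Int.toNat_natCast,
      show j + 1 + s (i + 1) = s (i + 1) + 1 + j by omega]
  refine Matrix.det_hessenberg (fun i j => binom (j + 1 + s (i + 1)) (((j + 1 : ℕ) : ℤ) -
      (((i + 1 : ℕ) : ℤ) - 1))) (fun i => (boundedSeqCount s (i + 1) (s i) : ℤ)) ?_ ?_ ?_ ?_ m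
  · simp [h0, boundedSeqCount]
  · intro j
    rw [hbinom (j + 1) j le_rfl, Nat.sub_self, Nat.choose_zero_right, Nat.cast_one]
  · intro i j h
    exact if_neg (by omega)
  · intro j
    -- the right side of the alternating sum is the binomial coefficient of `j` over `j + 1`
    have := alternating_sum_boundedSeqCount hs h0 j (j + 1)
    rw [Nat.choose_succ_self] at this
    rw [← Nat.cast_zero, ← this]
    refine Finset.sum_congr rfl fun i hi => ?_
    rw [hbinom i j (by simp at hi; omega)]

/-! ### Binary search trees of words -/

namespace BinaryTree

variable {A : Type*}

/-- The labels of a binary tree in the order left subtree, root, right subtree. -/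
def inorder : BinaryTree A → List A
  | nil => []
  | node b l r => l.inorder ++ b :: r.inorder

/-- The labels of a binary tree in the order root, left subtree, right subtree. -/
def preorder : BinaryTree A → List A
  | nil => []
  | node b l r => b :: (l.preorder ++ r.preorder)

theorem preorder_perm_inorder (t : BinaryTree A) : t.preorder.Perm t.inorder := by
  induction t with
  | nil => exact List.Perm.refl _
  | node b l r hl hr => exact ((hl.append hr).cons b).trans List.perm_middle.symm

variable [LinearOrder A]

/-- Binary search trees, with labels equal to the label of a node in its right subtree. -/
def IsSearchTree : BinaryTree A → Prop
  | nil => True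
  | node b l r =>
    (∀ x ∈ l.inorder, x < b) ∧ (∀ x ∈ r.inorder, b ≤ x) ∧ l.IsSearchTree ∧ r.IsSearchTree

/-- Insertion of a letter as a leaf of a binary search tree. -/
def searchInsert (x : A) : BinaryTree A → BinaryTree A
  | nil => node x nil nil
  | node b l r => if x < b then node b (l.searchInsert x) r else node b l (r.searchInsert x)

/-- The binary search tree obtained by inserting the letters of a word from left to right. -/
def ofWord (w : List A) : BinaryTree A := w.foldl (fun t x => t.searchInsert x) nil

theorem inorder_searchInsert_perm (x : A) (t : BinaryTree A) :
    (t.searchInsert x).inorder.Perm (x :: t.inorder) := by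
  induction t with
  | nil => exact List.Perm.refl _
  | node b l r hl hr =>
    rw [searchInsert]
    split_ifs
    · exact hl.append_right _
    · exact ((hr.cons b).append_left l.inorder).trans
        (((List.Perm.swap x b r.inorder).append_left _).trans List.perm_middle)

theorem IsSearchTree.searchInsert (x : A) {t : BinaryTree A} (ht : t.IsSearchTree) :
    (t.searchInsert x).IsSearchTree := by
  induction t with
  | nil => simp [BinaryTree.searchInsert, IsSearchTree, inorder]
  | node b l r hl hr =>
    obtain ⟨h1, h2, h3, h4⟩ := ht
    rw [BinaryTree.searchInsert]
    split_ifs with h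
    · refine ⟨fun y hy => ?_, h2, hl h3, h4⟩
      rcases List.mem_cons.1 ((inorder_searchInsert_perm x l).mem_iff.1 hy) with rfl | hy
      exacts [h, h1 y hy]
    · refine ⟨h1, fun y hy => ?_, h3, hr h4⟩
      rcases List.mem_cons.1 ((inorder_searchInsert_perm x r).mem_iff.1 hy) with rfl | hy
      exacts [not_lt.1 h, h2 y hy]

theorem ofWord_append (p q : List A) :
    ofWord (p ++ q) = q.foldl (fun t x => t.searchInsert x) (ofWord p) :=
  List.foldl_append

theorem ofWord_append_singleton (w : List A) (x : A) :
    ofWord (w ++ [x]) = (ofWord w).searchInsert x :=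
  ofWord_append w [x]

theorem isSearchTree_ofWord (w : List A) : (ofWord w).IsSearchTree := by
  induction w using List.reverseRecOn with
  | nil => trivial
  | append_singleton w x ih => exact ofWord_append_singleton w x ▸ ih.searchInsert x

theorem inorder_ofWord_perm (w : List A) : (ofWord w).inorder.Perm w := by
  induction w using List.reverseRecOn with
  | nil => exact List.Perm.refl _
  | append_singleton w x ih =>
    rw [ofWord_append_singleton]
    exact (inorder_searchInsert_perm x _).trans
      ((ih.cons x).trans (List.perm_append_singleton x w).symm)

theorem IsSearchTree.sortedLE_inorder {t : BinaryTree A} (ht : t.IsSearchTree) :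
    t.inorder.SortedLE := by
  rw [List.sortedLE_iff_pairwise]
  induction t with
  | nil => simp [inorder]
  | node b l r hl hr =>
    obtain ⟨h1, h2, h3, h4⟩ := ht
    rw [inorder, List.pairwise_append, List.pairwise_cons]
    refine ⟨hl h3, ⟨h2, hr h4⟩, fun x hx y hy => ?_⟩
    rcases List.mem_cons.1 hy with rfl | hy
    exacts [(h1 x hx).le, (h1 x hx).le.trans (h2 y hy)]

/-- Letters `a < b ≤ c` are separated at the label `b`, or higher in the tree. -/
theorem searchInsert_comm {a b c : A} (hab : a < b) (hbc : b ≤ c) {t : BinaryTree A}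
    (ht : t.IsSearchTree) (hb : b ∈ t.inorder) :
    (t.searchInsert a).searchInsert c = (t.searchInsert c).searchInsert a := by
  induction t with
  | nil => simp [inorder] at hb
  | node d l r hl hr =>
    obtain ⟨h1, h2, h3, h4⟩ := ht
    rw [inorder, List.mem_append, List.mem_cons] at hb
    by_cases hc : c < d
    · have ha : a < d := (hab.trans_le hbc).trans hc
      have hbl : b ∈ l.inorder := by
        rcases hb with hb | rfl | hb
        · exact hb
        · exact absurd hbc hc.not_ge
        · exact absurd (h2 b hb) (hbc.trans_lt hc).not_ge
      simp [searchInsert, ha, hc, hl h3 hbl]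
    · by_cases ha : a < d
      · simp [searchInsert, ha, hc]
      · have hbr : b ∈ r.inorder := by
          rcases hb with hb | rfl | hb
          · exact absurd ((hab.trans (h1 b hb))) ha
          · exact absurd hab ha
          · exact hb
        simp [searchInsert, ha, hc, hr h4 hbr]

theorem ofWord_eq_of_adj {w₁ w₂ : List A} (h : SharpSylvAdj w₁ w₂) : ofWord w₁ = ofWord w₂ := by
  obtain ⟨u, v, w, a, b, c, hab, hbc, rfl, rfl⟩ := h
  have hb : b ∈ (ofWord (u ++ [b] ++ v)).inorder := (inorder_ofWord_perm _).mem_iff.2 (by simp)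
  have := searchInsert_comm hab hbc (isSearchTree_ofWord _) hb
  rw [ofWord_append _ w, ofWord_append _ w, ofWord_append _ [a, c], ofWord_append _ [c, a]]
  exact congrArg (fun t => w.foldl (fun t x => t.searchInsert x) t) this

theorem foldl_searchInsert_left (b : A) (r : BinaryTree A) (w : List A) (hw : ∀ x ∈ w, x < b)
    (l : BinaryTree A) :
    w.foldl (fun t x => t.searchInsert x) (node b l r) =
      node b (w.foldl (fun t x => t.searchInsert x) l) r := by
  induction w generalizing l with
  | nil => rfl
  | cons x w ih =>
    rw [List.forall_mem_cons] at hw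
    rw [List.foldl_cons, searchInsert, if_pos hw.1, ih hw.2, List.foldl_cons]

theorem foldl_searchInsert_right (b : A) (l : BinaryTree A) (w : List A) (hw : ∀ x ∈ w, b ≤ x)
    (r : BinaryTree A) :
    w.foldl (fun t x => t.searchInsert x) (node b l r) =
      node b l (w.foldl (fun t x => t.searchInsert x) r) := by
  induction w generalizing r with
  | nil => rfl
  | cons x w ih =>
    rw [List.forall_mem_cons] at hw
    rw [List.foldl_cons, searchInsert, if_neg hw.1.not_gt, ih hw.2, List.foldl_cons]

theorem ofWord_preorder {t : BinaryTree A} (ht : t.IsSearchTree) : ofWord t.preorder = t := by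
  induction t with
  | nil => rfl
  | node b l r hl hr =>
    obtain ⟨h1, h2, h3, h4⟩ := ht
    rw [preorder, ofWord, List.foldl_cons, List.foldl_append]
    change List.foldl _ (List.foldl _ (node b nil nil) l.preorder) r.preorder = _
    rw [foldl_searchInsert_left b nil _ fun x hx => h1 x (l.preorder_perm_inorder.mem_iff.1 hx),
      foldl_searchInsert_right b _ _ fun x hx => h2 x (r.preorder_perm_inorder.mem_iff.1 hx)]
    exact congrArg₂ _ (hl h3) (hr h4)

end BinaryTree

/-! ### Classes and trees -/

section SharpSylvester

variable {A : Type*} [LinearOrder A]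

theorem sharpSylv_of_adj {w₁ w₂ : List A} (h : SharpSylvAdj w₁ w₂) : sharpSylvSetoid A w₁ w₂ :=
  Relation.EqvGen.rel _ _ h

theorem SharpSylvAdj.append (p q : List A) {w₁ w₂ : List A} (h : SharpSylvAdj w₁ w₂) :
    SharpSylvAdj (p ++ w₁ ++ q) (p ++ w₂ ++ q) := by
  obtain ⟨u, v, w, a, b, c, hab, hbc, rfl, rfl⟩ := h
  exact ⟨p ++ u, v, w ++ q, a, b, c, hab, hbc, by simp, by simp⟩

/-- `#`-Sylvester equivalence is a congruence for concatenation. -/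
theorem sharpSylv_append (p q : List A) {w₁ w₂ : List A} (h : sharpSylvSetoid A w₁ w₂) :
    sharpSylvSetoid A (p ++ w₁ ++ q) (p ++ w₂ ++ q) := by
  induction h with
  | rel _ _ h => exact sharpSylv_of_adj (h.append p q)
  | refl _ => exact (sharpSylvSetoid A).refl' _
  | symm _ _ _ ih => exact (sharpSylvSetoid A).symm' ih
  | trans _ _ _ _ _ ih₁ ih₂ => exact (sharpSylvSetoid A).trans' ih₁ ih₂

/-- After an occurrence of `b`, a letter smaller than `b` commutes with any word whose letters are
at least `b`. -/
theorem sharpSylv_move_right (b x : A) (hx : x < b) (u v : List A) (hv : ∀ y ∈ v, b ≤ y) :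
    sharpSylvSetoid A (b :: (u ++ x :: v)) (b :: (u ++ v ++ [x])) := by
  induction v generalizing u with
  | nil => simp
  | cons y v ih =>
    rw [List.forall_mem_cons] at hv
    have h : SharpSylvAdj (b :: (u ++ x :: y :: v)) (b :: (u ++ y :: x :: v)) :=
      ⟨[], u, v, x, b, y, hx, hv.1, by simp, by simp⟩
    have := ih (u ++ [y]) hv.2
    simp only [List.append_assoc, List.singleton_append] at this
    simpa only [List.append_assoc, List.cons_append] using
      (sharpSylvSetoid A).trans' (sharpSylv_of_adj h) this

theorem sharpSylv_preorder_searchInsert (x : A) {t : BinaryTree A} (ht : t.IsSearchTree) :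
    sharpSylvSetoid A (t.preorder ++ [x]) (t.searchInsert x).preorder := by
  induction t with
  | nil => exact (sharpSylvSetoid A).refl' _
  | node b l r hl hr =>
    obtain ⟨h1, h2, h3, h4⟩ := ht
    rw [BinaryTree.searchInsert]
    split_ifs with h
    · have e := sharpSylv_move_right b x h l.preorder r.preorder
        fun y hy => h2 y (r.preorder_perm_inorder.mem_iff.1 hy)
      have := sharpSylv_append [b] r.preorder (hl h3)
      simp only [BinaryTree.preorder, List.append_assoc, List.cons_append] at e this ⊢
      exact (sharpSylvSetoid A).trans' ((sharpSylvSetoid A).symm' e) this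
    · have := sharpSylv_append (b :: l.preorder) [] (hr h4)
      simpa [BinaryTree.preorder] using this

theorem sharpSylv_preorder_ofWord (w : List A) :
    sharpSylvSetoid A w (BinaryTree.ofWord w).preorder := by
  induction w using List.reverseRecOn with
  | nil => exact (sharpSylvSetoid A).refl' _
  | append_singleton w x ih =>
    rw [BinaryTree.ofWord_append_singleton]
    have := sharpSylv_append [] [x] ih
    simp only [List.nil_append] at this
    exact (sharpSylvSetoid A).trans' this
      (sharpSylv_preorder_searchInsert x (BinaryTree.isSearchTree_ofWord w))

/-- The binary search tree is a complete invariant of `#`-Sylvester classes. -/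
theorem sharpSylv_iff_ofWord_eq {w₁ w₂ : List A} :
    sharpSylvSetoid A w₁ w₂ ↔ BinaryTree.ofWord w₁ = BinaryTree.ofWord w₂ := by
  constructor
  · intro h
    induction h with
    | rel _ _ h => exact BinaryTree.ofWord_eq_of_adj h
    | refl _ => rfl
    | symm _ _ _ ih => exact ih.symm
    | trans _ _ _ _ _ ih₁ ih₂ => exact ih₁.trans ih₂
  · intro h
    have := sharpSylv_preorder_ofWord w₂
    rw [← h] at this
    exact (sharpSylvSetoid A).trans' (sharpSylv_preorder_ofWord w₁) ((sharpSylvSetoid A).symm' this)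

end SharpSylvester

/-- The word listing the letters of `as` in order, each letter `a` repeated `c a` times. -/
def repeatLetters {A : Type*} (c : A → ℕ) (as : List A) : List A :=
  as.flatMap fun a => List.replicate (c a) a

theorem length_repeatLetters {A : Type*} (c : A → ℕ) (as : List A) :
    (repeatLetters c as).length = ((as.map c).filter (fun m => m ≠ 0)).sum := by
  induction as with
  | nil => rfl
  | cons a as ih =>
    rw [repeatLetters, List.flatMap_cons, List.length_append, ← repeatLetters, ih, List.map_cons,
      List.length_replicate, List.filter_cons]
    by_cases ha : c a = 0 <;> simp [ha]

theorem count_repeatLetters {A : Type*} [LinearOrder A] (c : A → ℕ) {as : List A}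
    (h : as.Nodup) (a : A) :
    (repeatLetters c as).count a = if a ∈ as then c a else 0 := by
  induction as with
  | nil => simp [repeatLetters]
  | cons b as ih =>
    rw [List.nodup_cons] at h
    have := ih h.2
    rw [repeatLetters, List.flatMap_cons, List.count_append, ← repeatLetters, this,
      List.count_replicate]
    by_cases hab : a = b
    · subst hab; simp [h.1]
    · simp [hab, Ne.symm hab]

theorem sortedLE_repeatLetters {A : Type*} [LinearOrder A] (c : A → ℕ) {as : List A}
    (h : as.SortedLE) : (repeatLetters c as).SortedLE := by
  rw [List.sortedLE_iff_pairwise] at *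
  induction as with
  | nil => simp [repeatLetters]
  | cons b as ih =>
    rw [List.pairwise_cons] at h
    rw [repeatLetters, List.flatMap_cons, ← repeatLetters, List.pairwise_append]
    refine ⟨by simp [List.pairwise_replicate], ih h.2, fun x hx y hy => ?_⟩
    obtain rfl := List.eq_of_mem_replicate hx
    obtain ⟨a, ha, hy⟩ := List.mem_flatMap.1 hy
    obtain rfl := List.eq_of_mem_replicate hy
    exact h.1 y ha

/-- The binary search trees with a given inorder reading. -/
def searchTrees {A : Type*} [LinearOrder A] (L : List A) : Set (BinaryTree A) :=
  {t | t.IsSearchTree ∧ t.inorder = L}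

/-- Classes of content `c` correspond to the binary search trees whose inorder reading is the
weakly increasing word of content `c`. -/
theorem exists_bijOn_sharpSylvClasses {N : ℕ} (c : Fin N → ℕ) :
    ∃ f, Set.BijOn f (sharpSylvClasses c) (searchTrees (repeatLetters c (List.finRange N))) := by
  have hcount : ∀ w : List (Fin N), wordContent w = c ↔
      w.Perm (repeatLetters c (List.finRange N)) := by
    intro w
    rw [List.perm_iff_count, funext_iff]
    simp [count_repeatLetters c (List.nodup_finRange N), wordContent]
  have hsort : (repeatLetters c (List.finRange N)).SortedLE :=
    sortedLE_repeatLetters c (List.sortedLT_finRange N).sortedLE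
  refine ⟨Quotient.lift BinaryTree.ofWord fun _ _ h => sharpSylv_iff_ofWord_eq.1 h, ?_, ?_, ?_⟩
  · rintro _ ⟨w, hw, rfl⟩
    refine ⟨BinaryTree.isSearchTree_ofWord w, ?_⟩
    exact ((BinaryTree.inorder_ofWord_perm w).trans ((hcount w).1 hw)).eq_of_sortedLE
      (BinaryTree.isSearchTree_ofWord w).sortedLE_inorder hsort
  · rintro _ ⟨w₁, -, rfl⟩ _ ⟨w₂, -, rfl⟩ h
    exact Quotient.sound (sharpSylv_iff_ofWord_eq.2 h)
  · rintro t ⟨ht, hin⟩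
    refine ⟨_, ⟨t.preorder, (hcount _).2 (hin ▸ t.preorder_perm_inorder), rfl⟩, ?_⟩
    exact BinaryTree.ofWord_preorder ht

/-! ### The path descending to the right -/

namespace BinaryTree

variable {A : Type*}

/-- The number of nodes on the path that starts at the root and descends to the right. -/
def rightSpine : BinaryTree A → ℕ
  | nil => 0
  | node _ _ r => r.rightSpine + 1

/-- The tree with a new node, labelled `a`, in place of the subtree whose root is at depth `i` on
the path descending to the right; that subtree becomes the left subtree of the new node. For
`i = t.rightSpine` the new node is a leaf; larger values of `i` are not meaningful. -/
def addMax (a : A) : ℕ → BinaryTree A → BinaryTree A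
  | 0, t => node a t nil
  | _ + 1, nil => nil
  | i + 1, node b l r => node b l (addMax a i r)

theorem rightSpine_le_length (t : BinaryTree A) : t.rightSpine ≤ t.inorder.length := by
  induction t with
  | nil => exact le_rfl
  | node b l r hl hr => simp only [rightSpine, inorder, List.length_append, List.length_cons]; omega

theorem inorder_addMax (a : A) {i : ℕ} {t : BinaryTree A} (h : i ≤ t.rightSpine) :
    (t.addMax a i).inorder = t.inorder ++ [a] := by
  induction i generalizing t with
  | zero => simp [addMax, inorder]
  | succ i ih =>
    cases t with
    | nil => simp [rightSpine] at h
    | node b l r => simp [addMax, inorder, ih (Nat.le_of_succ_le_succ h)]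

theorem rightSpine_addMax (a : A) {i : ℕ} {t : BinaryTree A} (h : i ≤ t.rightSpine) :
    (t.addMax a i).rightSpine = i + 1 := by
  induction i generalizing t with
  | zero => rfl
  | succ i ih =>
    cases t with
    | nil => simp [rightSpine] at h
    | node b l r => simp [addMax, rightSpine, ih (Nat.le_of_succ_le_succ h)]

theorem addMax_injective (a : A) {i : ℕ} {t t' : BinaryTree A} (h : i ≤ t.rightSpine)
    (h' : i ≤ t'.rightSpine) (e : t.addMax a i = t'.addMax a i) : t = t' := by
  induction i generalizing t t' with
  | zero => simpa [addMax] using e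
  | succ i ih =>
    cases t with
    | nil => simp [rightSpine] at h
    | node b l r =>
      cases t' with
      | nil => simp [rightSpine] at h'
      | node b' l' r' =>
        simp only [addMax, node.injEq] at e
        rw [e.1, e.2.1, ih (Nat.le_of_succ_le_succ h) (Nat.le_of_succ_le_succ h') e.2.2]

/-- Every nonempty tree arises by inserting its last label in inorder. -/
theorem exists_eq_addMax {t : BinaryTree A} (h : t ≠ nil) :
    ∃ a i, ∃ t' : BinaryTree A, i ≤ t'.rightSpine ∧ t = t'.addMax a i := by
  induction t with
  | nil => exact absurd rfl h
  | node b l r _ ih =>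
    by_cases hr : r = nil
    · exact ⟨b, 0, l, Nat.zero_le _, by rw [hr]; rfl⟩
    · obtain ⟨a, i, r', hi, rfl⟩ := ih hr
      exact ⟨a, i + 1, node b l r', Nat.succ_le_succ hi, rfl⟩

theorem exists_eq_addMax_of_inorder {t : BinaryTree A} {L : List A} {a : A}
    (h : t.inorder = L ++ [a]) :
    ∃ i, ∃ t' : BinaryTree A, i ≤ t'.rightSpine ∧ t'.inorder = L ∧ t = t'.addMax a i := by
  obtain ⟨b, i, t', hi, rfl⟩ := exists_eq_addMax (t := t) (by rintro rfl; simp [inorder] at h)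
  rw [inorder_addMax b hi] at h
  obtain ⟨h₁, h₂⟩ := List.append_inj' h rfl
  obtain rfl : b = a := by simpa using h₂
  exact ⟨i, t', hi, h₁, rfl⟩

variable [LinearOrder A]

theorem IsSearchTree.addMax {a : A} {i : ℕ} {t : BinaryTree A} (ht : t.IsSearchTree)
    (h : i ≤ t.rightSpine) (hle : ∀ x ∈ t.inorder, x ≤ a)
    (hlt : i < t.rightSpine → ∀ x ∈ t.inorder, x < a) : (t.addMax a i).IsSearchTree := by
  induction i generalizing t with
  | zero =>
    refine ⟨fun x hx => ?_, by simp [inorder], ht, trivial⟩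
    cases t with
    | nil => simp [inorder] at hx
    | node b l r => exact hlt (Nat.succ_pos _) x hx
  | succ i ih =>
    cases t with
    | nil => simp [rightSpine] at h
    | node b l r =>
      obtain ⟨h1, h2, h3, h4⟩ := ht
      have hi : i ≤ r.rightSpine := Nat.le_of_succ_le_succ h
      refine ⟨h1, fun x hx => ?_, h3, ih h4 hi (fun x hx => hle x ?_)
        fun hi x hx => hlt (Nat.succ_lt_succ hi) x ?_⟩
      · rw [inorder_addMax a hi, List.mem_append, List.mem_singleton] at hx
        rcases hx with hx | rfl
        exacts [h2 x hx, hle b (by simp [inorder])]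
      all_goals simp [inorder, hx]

theorem IsSearchTree.of_addMax {a : A} {i : ℕ} {t : BinaryTree A} (h : i ≤ t.rightSpine)
    (ht : (t.addMax a i).IsSearchTree) : t.IsSearchTree := by
  induction i generalizing t with
  | zero => exact ht.2.2.1
  | succ i ih =>
    cases t with
    | nil => trivial
    | node b l r =>
      obtain ⟨h1, h2, h3, h4⟩ := ht
      have hi : i ≤ r.rightSpine := Nat.le_of_succ_le_succ h
      exact ⟨h1, fun x hx => h2 x (by simp [inorder_addMax a hi, hx]), h3, ih hi h4⟩

/-- A label equal to the previous one can be added only as a leaf. -/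
theorem IsSearchTree.lt_of_addMax {a b : A} {i : ℕ} {t : BinaryTree A} (h : i < t.rightSpine)
    (ht : (t.addMax a i).IsSearchTree) (hb : b ∈ t.inorder.getLast?) : b < a := by
  induction i generalizing t with
  | zero => exact ht.1 b (List.mem_of_mem_getLast? hb)
  | succ i ih =>
    cases t with
    | nil => simp [rightSpine] at h
    | node d l r =>
      have hi : i < r.rightSpine := Nat.lt_of_succ_lt_succ h
      refine ih hi ht.2.2.2 ?_
      have hr : r.inorder ≠ [] := by
        intro e
        have := r.rightSpine_le_length
        rw [e, List.length_nil] at this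
        omega
      simpa [inorder, List.getLast?_append_of_ne_nil, List.getLast?_cons,
        List.getLast?_eq_some_getLast hr] using hb

end BinaryTree

/-! ### Counting trees -/

section Counting

open BinaryTree

variable {A : Type*} [LinearOrder A]

/-- The binary search trees with inorder reading `L` whose path descending to the right has at
least `L.length - x` nodes. -/
def deepSearchTrees (L : List A) (x : ℕ) : Set (BinaryTree A) :=
  {t | t ∈ searchTrees L ∧ L.length ≤ t.rightSpine + x}

theorem rightSpine_le_of_mem_searchTrees {L : List A} {t : BinaryTree A} (ht : t ∈ searchTrees L) :
    t.rightSpine ≤ L.length :=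
  ht.2 ▸ t.rightSpine_le_length

theorem deepSearchTrees_length (L : List A) : deepSearchTrees L L.length = searchTrees L := by
  ext t
  simp [deepSearchTrees]

theorem encard_deepSearchTrees_nil (x : ℕ) : (deepSearchTrees ([] : List A) x).encard = 1 := by
  rw [Set.encard_eq_one]
  refine ⟨nil, Set.eq_singleton_iff_unique_mem.2 ⟨⟨⟨trivial, rfl⟩, Nat.zero_le _⟩, ?_⟩⟩
  rintro (_ | ⟨b, l, r⟩) ⟨⟨-, h⟩, -⟩
  · rfl
  · simp [inorder] at h

/-- A new largest letter can be added at each depth of the path descending to the right. -/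
theorem encard_rightSpine_eq_of_lt {L : List A} {a : A} (h : ∀ b ∈ L, b < a) (y : ℕ) :
    {t | t ∈ searchTrees (L ++ [a]) ∧ t.rightSpine + y = L.length + 1}.encard =
      if y ≤ L.length then (deepSearchTrees L y).encard else 0 := by
  split_ifs with hy
  · have hinj : Set.InjOn (BinaryTree.addMax a (L.length - y)) (deepSearchTrees L y) := by
      rintro t ⟨-, h₁⟩ t' ⟨-, h₂⟩ e
      exact addMax_injective a (by omega) (by omega) e
    rw [← hinj.encard_image]
    congr 1
    ext t
    constructor
    · rintro ⟨⟨h₁, h₂⟩, h₃⟩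
      obtain ⟨i, t', hi, hL, rfl⟩ := exists_eq_addMax_of_inorder h₂
      rw [rightSpine_addMax a hi] at h₃
      obtain rfl : i = L.length - y := by omega
      exact ⟨t', ⟨⟨h₁.of_addMax hi, hL⟩, by omega⟩, rfl⟩
    · rintro ⟨t', ⟨⟨h₁, rfl⟩, h₂⟩, rfl⟩
      have hi : t'.inorder.length - y ≤ t'.rightSpine := by omega
      refine ⟨⟨h₁.addMax hi (fun x hx => (h x hx).le) fun _ => h, inorder_addMax a hi⟩, ?_⟩
      rw [rightSpine_addMax a hi]
      omega
  · rw [Set.encard_eq_zero, Set.eq_empty_iff_forall_notMem]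
    rintro t ⟨⟨-, h₂⟩, h₃⟩
    obtain ⟨i, t', hi, hL, rfl⟩ := exists_eq_addMax_of_inorder h₂
    rw [rightSpine_addMax a hi] at h₃
    omega

theorem encard_deepSearchTrees_append_of_lt {L : List A} {a : A} (h : ∀ b ∈ L, b < a) (x : ℕ) :
    (deepSearchTrees (L ++ [a]) x).encard =
      ∑ y ∈ Finset.range (x + 1), if y ≤ L.length then (deepSearchTrees L y).encard else 0 := by
  induction x with
  | zero =>
    rw [Finset.sum_range_one, ← encard_rightSpine_eq_of_lt h 0]
    congr 1
    ext t
    refine and_congr_right fun ht => ?_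
    have := rightSpine_le_of_mem_searchTrees ht
    simp only [List.length_append, List.length_singleton] at this ⊢
    omega
  | succ x ih =>
    rw [Finset.sum_range_succ, ← ih, ← encard_rightSpine_eq_of_lt h (x + 1),
      ← Set.encard_union_eq]
    · congr 1
      ext t
      simp only [deepSearchTrees, Set.mem_union, Set.mem_ofPred_eq, ← and_or_left,
        List.length_append, List.length_singleton]
      refine and_congr_right fun _ => ?_
      omega
    · rw [Set.disjoint_left]
      rintro t ⟨-, h₁⟩ ⟨-, h₂⟩
      simp only [List.length_append, List.length_singleton] at h₁
      omega

theorem encard_deepSearchTrees_append_same {L : List A} {a : A} (h : ∀ b ∈ L, b ≤ a) (x : ℕ) :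
    (deepSearchTrees (L ++ [a] ++ [a]) x).encard = (deepSearchTrees (L ++ [a]) x).encard := by
  have hinj : Set.InjOn (fun t : BinaryTree A => t.addMax a t.rightSpine)
      (deepSearchTrees (L ++ [a]) x) := by
    intro t _ t' _ e
    have e' : t.addMax a t.rightSpine = t'.addMax a t'.rightSpine := e
    have hs := congrArg rightSpine e'
    rw [rightSpine_addMax a le_rfl, rightSpine_addMax a le_rfl, Nat.succ_inj] at hs
    rw [hs] at e'
    exact addMax_injective a hs.ge le_rfl e'
  rw [← hinj.encard_image]
  congr 1
  ext t
  constructor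
  · rintro ⟨⟨h₁, h₂⟩, h₃⟩
    obtain ⟨i, t', hi, hL, rfl⟩ := exists_eq_addMax_of_inorder h₂
    obtain rfl : i = t'.rightSpine := by
      refine hi.eq_or_lt.resolve_right fun hlt => ?_
      exact lt_irrefl a (h₁.lt_of_addMax hlt (by simp [hL]))
    rw [rightSpine_addMax a hi, List.length_append (as := L ++ [a]), List.length_singleton] at h₃
    exact ⟨t', ⟨⟨h₁.of_addMax hi, hL⟩, by omega⟩, rfl⟩
  · rintro ⟨t', ⟨⟨h₁, h₂⟩, h₃⟩, rfl⟩
    refine ⟨⟨h₁.addMax le_rfl (fun b hb => ?_) fun hlt => absurd hlt (lt_irrefl _), ?_⟩, ?_⟩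
    · rw [h₂, List.mem_append, List.mem_singleton] at hb
      rcases hb with hb | rfl
      exacts [h b hb, le_rfl]
    · simp only [inorder_addMax a le_rfl, h₂]
    · simp only [rightSpine_addMax a le_rfl, List.length_append (as := L ++ [a]),
        List.length_singleton]
      omega

theorem encard_deepSearchTrees_append_replicate {L : List A} {a : A} (h : ∀ b ∈ L, b < a)
    (m x : ℕ) :
    (deepSearchTrees (L ++ List.replicate (m + 1) a) x).encard =
      (deepSearchTrees (L ++ [a]) x).encard := by
  induction m with
  | zero => rfl
  | succ m ih =>
    rw [← ih, List.replicate_succ' (n := m + 1), List.replicate_succ' (n := m),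
      ← List.append_assoc, ← List.append_assoc]
    refine encard_deepSearchTrees_append_same (fun b hb => ?_) x
    rcases List.mem_append.1 hb with hb | hb
    exacts [(h b hb).le, (List.eq_of_mem_replicate hb).le]

/-- The trees of a given inorder reading, refined by the path descending to the right, satisfy the
recursion of the bounded sequences, one step for each letter that occurs. -/
theorem encard_deepSearchTrees_repeatLetters (c : A → ℕ) {as : List A} (has : as.SortedLT) (x : ℕ) :
    (deepSearchTrees (repeatLetters c as) x).encard =
      boundedSeqCount (fun i => (((as.map c).filter (fun m => m ≠ 0)).take i).sum)
        ((as.map c).filter (fun m => m ≠ 0)).length x := by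
  rw [List.sortedLT_iff_pairwise] at has
  induction as using List.reverseRecOn generalizing x with
  | nil => simp [repeatLetters, encard_deepSearchTrees_nil, boundedSeqCount]
  | append_singleton as a ih =>
    rw [List.pairwise_append] at has
    have ih := ih has.1
    have hrep : repeatLetters c (as ++ [a]) = repeatLetters c as ++ List.replicate (c a) a := by
      simp [repeatLetters]
    rw [hrep, List.map_append, List.filter_append]
    have hlt : ∀ b ∈ repeatLetters c as, b < a := by
      intro b hb
      obtain ⟨d, hd, hb⟩ := List.mem_flatMap.1 hb
      obtain rfl := List.eq_of_mem_replicate hb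
      exact has.2.2 b hd a (by simp)
    have hlen := length_repeatLetters c as
    set bs := (as.map c).filter (fun m => m ≠ 0) with hbs
    rcases hca : c a with _ | m
    · simpa [hca] using ih x
    · have hfilter : (List.map c [a]).filter (fun m => m ≠ 0) = [m + 1] := by simp [hca]
      rw [hfilter, List.length_append, List.length_singleton, boundedSeqCount,
        encard_deepSearchTrees_append_replicate hlt, encard_deepSearchTrees_append_of_lt hlt,
        Nat.cast_sum]
      refine Finset.sum_congr rfl fun y _ => ?_
      rw [hlen, ih y, List.take_left, Nat.cast_ite, Nat.cast_zero]
      congr 2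
      refine boundedSeqCount_congr _ _ fun i hi => ?_
      rw [List.take_append_of_le_length hi.le]

end Counting

theorem corollary4p8 {n : ℕ} (α : Composition n) {N : ℕ} (c : Fin N → ℕ)
    (hc : packing c = α.blocks) :
    (sharpSylvClasses c).Finite ∧
      ((sharpSylvClasses c).ncard : ℤ) = (sharpSylvMatrix α).det := by
  obtain ⟨f, hf⟩ := exists_bijOn_sharpSylvClasses c
  have hblocks : ((List.finRange N).map c).filter (fun m => m ≠ 0) = α.blocks := by
    rw [← hc, packing, List.ofFn_eq_map]
  have hlen : (repeatLetters c (List.finRange N)).length = n := by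
    rw [length_repeatLetters, hblocks, α.blocks_sum]
  have hcard : (sharpSylvClasses c).encard = boundedSeqCount α.sizeUpTo α.length n := by
    have := encard_deepSearchTrees_repeatLetters c (List.sortedLT_finRange N) n
    rw [hblocks] at this
    rw [← hf.injOn.encard_image, hf.image_eq, ← deepSearchTrees_length, hlen, this]
    rfl
  refine ⟨Set.finite_of_encard_eq_coe hcard, ?_⟩
  rw [Set.ncard_def, hcard, ENat.toNat_natCast]
  have hdet := det_binom_eq_boundedSeqCount α.monotone_sizeUpTo α.sizeUpTo_zero (α.length - 1)
  refine Eq.trans ?_ hdet.symm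
  rcases hk : α.length with _ | k
  · simp [boundedSeqCount]
  · rw [boundedSeqCount_succ_of_le k (α.sizeUpTo_le k), Nat.add_sub_cancel,
      boundedSeqCount_succ_of_le k le_rfl]
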